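/- Let $q$ be an odd prime power, let $\omega$ be a primitive element of $\mathbb F_{q^3}$, let $\mathrm{Tr}$ be the trace from $\mathbb F_{q^3}$ to $\mathbb F_q$, and put $n=q^2+q+1$. Let $N$ be a positive integer dividing $n$ and let $M=n/N$. View $\mathbb F_{q^3}$ as a $3$-dimensional $\mathbb F_q$-vector space underlying $\mathrm{PG}(2,q)$, and assume that the set of points $\langle\omega^N\rangle/\mathbb F_q^*=\{x\mathbb F_q^* : x\in\langle\omega^N\rangle\}$ is an $M$-arc in $\mathrm{PG}(2,q)$, i.e. it consists of $M$ points no three of which are collinear. Let $S=\{i \bmod n:\mathrm{Tr}(\omega^i)=0\}$ and $W=\{i \bmod n:\mathrm{Tr}(\omega^{2i})=0\}$, as subsets of $\mathbb Z_n$. Let $I_1$ be the set of those $i\in\mathbb Z_N$ for which exactly two elements $s\in S$ satisfy $s\equiv i\pmod N$, and let $2^{-1}I_1=\{2^{-1}i: i\in I_1\}\subseteq\mathbb Z_N$ (note that $N$ is odd). Choose $d_0\in W$ and, for the elements of $W$, integers representing them modulo $n$ (denoted by the same letters when they occur in exponents). Put $$\mathcal X=\{\omega^{d}\,\mathrm{Tr}(\omega^{d_0+d})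 : d\in W,\ d\neq d_0\}\cup\{2\omega^{d_0}\},\qquad X=\{\log_\omega(x) \bmod 2n : x\in\mathcal X\}\subseteq\mathbb Z_{2n},$$ and let $X_1$ be the multiset $[\,x \bmod 2N : x\in X,\ x \bmod N\in 2^{-1}I_1\,]$ over $\mathbb Z_{2N}$. Say that $X_1$ is purely a subset of $\mathbb Z_{2N}$ if every element of $\mathbb Z_{2N}$ appears in $X_1$ with multiplicity at most one. Let $\eta$ be the quadratic character of $\mathbb F_{q^3}$. Then $X_1$ is purely a subset of $\mathbb Z_{2N}$ if and only if $$\eta(2)\neq\eta\bigl(1+\omega^{\ell(q^3-1)/M}\bigr)\quad\text{for all }\ell\in\{1,2,\ldots,M-1\}.$$ -/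

import Mathlib

open scoped LinearAlgebra.Projectivization

noncomputable section

namespace ConicReduction

/-! Throughout, `F` is the field with `q` elements, `K` its cubic extension and `ω` a primitive
element of `K`; `K` is regarded as a three-dimensional vector space over `F`. -/

/-- A primitive element of the finite field `K`: a generator of its multiplicative group. -/
def IsPrimitiveElement {K : Type*} [Field K] (ω : Kˣ) : Prop :=
  ∀ x : Kˣ, x ∈ Subgroup.zpowers ω

/-- The number `q² + q + 1` of points of `PG(2,q)`, where `q = |F|`. -/
abbrev numPoints (F : Type*) [Fintype F] : ℕ := Fintype.card F ^ 2 + Fintype.card F + 1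

/-- A set of points of the projective space of `V` is an `M`-arc if it has `M` points and no
three distinct points of it lie on a common line (a two-dimensional subspace of `V`). -/
def IsArc {F V : Type*} [Field F] [AddCommGroup V] [Module F V] (M : ℕ) (A : Set (ℙ F V)) :
    Prop :=
  A.ncard = M ∧
    ∀ x ∈ A, ∀ y ∈ A, ∀ z ∈ A, x ≠ y → x ≠ z → y ≠ z →
      ¬ ∃ L : Submodule F V, Module.finrank F L = 2 ∧
        x.submodule ≤ L ∧ y.submodule ≤ L ∧ z.submodule ≤ L

/-- The set `C₀ / F*` of points `⟨x⟩` of `PG(2,q)`, where `x` runs through the cyclotomic class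
`C₀ = ⟨ω ^ N⟩`. -/
def cyclotomicPoints (F : Type*) {K : Type*} [Field F] [Field K] [Algebra F K] (ω : Kˣ) (N : ℕ) :
    Set (ℙ F K) :=
  {P | ∃ x ∈ Subgroup.zpowers (ω ^ N), P = Projectivization.mk F (x : K) x.ne_zero}

section

variable (F : Type*) {K : Type*} [Field F] [Fintype F] [Field K] [Algebra F K] (ω : Kˣ)

/-- The Singer difference set `S = {i mod (q² + q + 1) : Tr(ω ^ i) = 0}`. -/
def singerSet : Set (ZMod (numPoints F)) :=
  (fun i : ℤ => (i : ZMod (numPoints F))) '' {i | Algebra.trace F K ((ω ^ i : Kˣ) : K) = 0}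

/-- `W = {i mod (q² + q + 1) : Q(ω ^ i) = 0}`, the exponents of the points of the conic defined
by the quadratic form `Q(x) = Tr(x ^ 2)`. -/
def conicSet : Set (ZMod (numPoints F)) :=
  (fun i : ℤ => (i : ZMod (numPoints F))) ''
    {i | Algebra.trace F K (((ω ^ i : Kˣ) : K) ^ 2) = 0}

/-- The multiplicity `c_i` of `i` in the reduction of `S` modulo `N`. Here and below,
`ZMod.cast` is only used as the reduction `ℤ/m → ℤ/k` for `k ∣ m`. -/
def singerMult (N : ℕ) (i : ZMod N) : ℕ :=
  {s : ZMod (numPoints F) | s ∈ singerSet F ω ∧ (s.cast : ZMod N) = i}.ncard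

/-- `I₁ = {i ∈ ℤ/N : c_i = 2}`. -/
def I₁ (N : ℕ) : Set (ZMod N) := {i | singerMult F ω N i = 2}

/-- `2⁻¹ I₁ ⊆ ℤ/N` (used for odd `N`, so that `2` is invertible). -/
def halfI₁ (N : ℕ) : Set (ZMod N) := (fun i => (2 : ZMod N)⁻¹ * i) '' I₁ F ω N

/-- The set of the `ω ^ d * Tr(ω ^ (d₀ + d))`, for the elements `d ≠ d₀` of `W`, together with
`2 * ω ^ d₀`. Here `d₀ ∈ W`, and `r i` is the integer representing the class
`i` modulo `q² + q + 1` that is used in exponents of `ω`. -/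
def conicElements (r : ZMod (numPoints F) → ℤ) (d₀ : ZMod (numPoints F)) : Set K :=
  {x | ∃ d ∈ conicSet F ω, d ≠ d₀ ∧
      x = ((ω ^ r d : Kˣ) : K) *
        algebraMap F K (Algebra.trace F K ((ω ^ (r d₀ + r d) : Kˣ) : K))} ∪
    {2 * ((ω ^ r d₀ : Kˣ) : K)}

/-- `X_Q`: the discrete logarithms to the base `ω`, modulo `2(q² + q + 1)`, of the elements of
`conicElements`. -/
def XQ (r : ZMod (numPoints F) → ℤ) (d₀ : ZMod (numPoints F)) :
    Set (ZMod (2 * numPoints F)) :=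
  (fun k : ℤ => (k : ZMod (2 * numPoints F))) ''
    {k | ((ω ^ k : Kˣ) : K) ∈ conicElements F ω r d₀}

open Classical in
/-- The multiset `X₁ = [x mod 2N : x ∈ X_Q, x mod N ∈ 2⁻¹ I₁]` over `ℤ/2N`. -/
def X₁ (N : ℕ) (r : ZMod (numPoints F) → ℤ) (d₀ : ZMod (numPoints F)) :
    Multiset (ZMod (2 * N)) :=
  (Finset.univ.filter fun x : ZMod (2 * numPoints F) =>
      x ∈ XQ F ω r d₀ ∧ (x.cast : ZMod N) ∈ halfI₁ F ω N).val.map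
    fun x => (x.cast : ZMod (2 * N))

end

open Classical in
/-- A multiset over `G` is purely a subset of `G` if every element of `G` appears in it with
multiplicity at most one. -/
def IsPurelySubset {G : Type*} (X : Multiset G) : Prop := ∀ g : G, X.count g ≤ 1

end ConicReduction

end

/-! Since $n$ is odd, a class modulo $2n$ is a class modulo $n$ together with a parity. The element
of $\mathcal X$ attached to $d\in W$ differs from $\omega^d$ by a factor in $\mathbb F_q^*$, so its
logarithm is $d$ modulo $n$; the parity of the logarithm is read off from $\eta$. Hence the elements
attached to $d\ne d'$ collide modulo $2N$ exactly when $d\equiv d'\pmod N$ and their product is a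
square.

The character of that product is found in two steps. The Gram matrix of three points on the conic
$\mathrm{Tr}(x^2)=0$ has zero diagonal and determinant twice the product of the three mixed traces;
it is also the square of a determinant of conjugates. This removes $d_0$ (`quadraticChar_gram`,
`quadraticChar_zpow_add`) and leaves $\eta(2xy\,\mathrm{Tr}(xy))$ with $x=\omega^d$,
$y=\omega^{d'}$. With $u=y/x$, the conic equations turn this into $\eta(2)\eta(1+u^{q-1})$
(`trace_mul_identity`, `quadraticChar_trace_mul`).

For $d\equiv d'\pmod N$ the power $u^{q-1}$ is some $\omega^{\ell(q^3-1)/M}$ with $0<\ell<M$, and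
every such $\ell$ occurs because every nontrivial ratio is realised on the conic
(`exists_conic_pair`). The arc hypothesis puts each congruent pair into the part selected by $I_1$
(`mem_halfI₁_of_pair`). -/

namespace ConicReduction

/-! ### Conjugates, traces and quadratic characters on the conic. -/

section Algebra

variable {F K : Type*} [Field F] [Fintype F] [Field K] [Fintype K] [Algebra F K]

theorem algebraMap_trace_eq (hK : Module.finrank F K = 3) (x : K) :
    algebraMap F K (Algebra.trace F K x) =
      x + x ^ Fintype.card F + (x ^ Fintype.card F) ^ Fintype.card F := by
  rw [FiniteField.algebraMap_trace_eq_sum_pow, hK]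
  simp [Finset.sum_range_succ, Nat.card_eq_fintype_card, pow_two, pow_mul]

theorem pow_card_pow_card_pow_card (hK : Module.finrank F K = 3) (x : K) :
    ((x ^ Fintype.card F) ^ Fintype.card F) ^ Fintype.card F = x := by
  have h := FiniteField.pow_card x
  rw [Module.card_eq_pow_finrank (K := F) (V := K), hK] at h
  rw [← pow_mul, ← pow_mul]
  convert h using 2
  ring

theorem add_pow_card_base {F K : Type*} [Field F] [Fintype F] [Field K] [Algebra F K]
    (x y : K) :
    (x + y) ^ Fintype.card F = x ^ Fintype.card F + y ^ Fintype.card F := by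
  have := map_add (FiniteField.frobeniusAlgHom F K) x y
  simpa [FiniteField.coe_frobeniusAlgHom] using this

theorem sub_pow_card_base {F K : Type*} [Field F] [Fintype F] [Field K] [Algebra F K]
    (x y : K) :
    (x - y) ^ Fintype.card F = x ^ Fintype.card F - y ^ Fintype.card F := by
  have := map_sub (FiniteField.frobeniusAlgHom F K) x y
  simpa [FiniteField.coe_frobeniusAlgHom] using this

theorem algebraMap_pow_card {F K : Type*} [Field F] [Fintype F] [Field K] [Algebra F K]
    (c : F) :
    (algebraMap F K c) ^ Fintype.card F = algebraMap F K c := by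
  rw [← map_pow, FiniteField.pow_card]

/-- Elements fixed by the relative Frobenius lie in the base field. -/
theorem exists_algebraMap_eq_of_pow_card_eq (hK : Module.finrank F K = 3) {x : K}
    (hx : x ^ Fintype.card F = x) : ∃ c : F, algebraMap F K c = x := by
  -- An element of trace 1 is used because $\mathrm{Tr}(x)=3x$ would not recover $x$ in
  -- characteristic 3.
  obtain ⟨c, hc⟩ := Algebra.trace_surjective F K 1
  refine ⟨Algebra.trace F K (x * c), ?_⟩
  have h := algebraMap_trace_eq hK c
  rw [algebraMap_trace_eq hK, mul_pow, mul_pow, hx, hx]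
  rw [hc, map_one] at h
  linear_combination -x * h

theorem quadraticChar_pow_card {F K : Type*} [Fintype F] [Field K] [Fintype K]
    [DecidableEq K] (hodd : Odd (Fintype.card F)) (x : K) :
    quadraticChar K (x ^ Fintype.card F) = quadraticChar K x := by
  rw [map_pow]
  obtain ⟨m, hm⟩ := hodd
  by_cases hx : x = 0
  · simp [hx, hm]
  · rw [hm, pow_succ, pow_mul, quadraticChar_sq_one hx, one_pow, one_mul]

theorem quadraticChar_ne_iff {K : Type*} [Field K] [Fintype K] [DecidableEq K]
    {a b : K} (ha : a ≠ 0) (hb : b ≠ 0) :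
    quadraticChar K a ≠ quadraticChar K b ↔ quadraticChar K a * quadraticChar K b ≠ 1 := by
  rcases quadraticChar_dichotomy ha with h | h <;>
    rcases quadraticChar_dichotomy hb with h' | h' <;> simp [h, h']

theorem ringChar_ne_two {F K : Type*} [Field F] [Fintype F] [Field K] [Algebra F K]
    (hodd : Odd (Fintype.card F)) : ringChar K ≠ 2 := by
  intro h
  have h2 : (2 : K) = 0 := by
    have := ringChar.Nat.cast_ringChar (R := K)
    rw [h] at this; exact_mod_cast this
  have hF : (2 : F) = 0 := (algebraMap F K).injective (by rw [map_ofNat, h2, map_zero])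
  obtain ⟨m, hm⟩ := hodd
  have := FiniteField.cast_card_eq_zero F
  rw [hm] at this
  push_cast at this
  rw [hF] at this
  simp at this

theorem two_ne_zero_of_odd_card {F K : Type*} [Field F] [Fintype F] [Field K]
    [Algebra F K] (hodd : Odd (Fintype.card F)) : (2 : K) ≠ 0 :=
  Ring.two_ne_zero (ringChar_ne_two hodd)

/-- Two points `x`, `y` of the conic `Tr(x²) = 0`: with `u = y / x`, the trace `Tr(xy)` is
expressed by the conjugates of `u`. -/
theorem trace_mul_identity (hK : Module.finrank F K = 3) {x y u : K} (hy : y = x * u)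
    (hx2 : Algebra.trace F K (x ^ 2) = 0) (hy2 : Algebra.trace F K (y ^ 2) = 0) :
    (u + u ^ Fintype.card F) ^ Fintype.card F * algebraMap F K (Algebra.trace F K (x * y)) =
      x ^ 2 * ((u - (u ^ Fintype.card F) ^ Fintype.card F) *
        (u - (u ^ Fintype.card F) ^ Fintype.card F) ^ Fintype.card F) := by
  have h1 := algebraMap_trace_eq hK (x ^ 2)
  have h2 := algebraMap_trace_eq hK (y ^ 2)
  rw [hx2, map_zero] at h1
  rw [hy2, map_zero] at h2
  rw [algebraMap_trace_eq hK, add_pow_card_base, sub_pow_card_base,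
    pow_card_pow_card_pow_card hK]
  simp only [hy, mul_pow, fun a : K => pow_right_comm a 2 (Fintype.card F)] at h1 h2 ⊢
  set u₁ := u ^ Fintype.card F
  set u₂ := u₁ ^ Fintype.card F
  set x₁ := x ^ Fintype.card F
  set x₂ := x₁ ^ Fintype.card F
  -- Subtracting these multiples of the two conic equations cancels the terms in $x_1^2$ and
  -- $x_2^2$; the coefficient of $x^2$ left over is $(u-u_2)(u_1-u)$.
  linear_combination -(u₁ * u₂) * h1 - h2

theorem pow_card_pow_card_ne (hK : Module.finrank F K = 3) {u : K}
    (hu : u ^ Fintype.card F ≠ u) : u - (u ^ Fintype.card F) ^ Fintype.card F ≠ 0 := by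
  intro h
  apply hu
  nth_rewrite 1 [sub_eq_zero.1 h]
  exact pow_card_pow_card_pow_card hK u

/-- Two distinct points of this conic are never conjugate: the right side of `trace_mul_identity`
does not vanish. -/
theorem trace_mul_ne_zero (hK : Module.finrank F K = 3) {x y u : K} (hx : x ≠ 0)
    (hy : y = x * u) (hx2 : Algebra.trace F K (x ^ 2) = 0)
    (hy2 : Algebra.trace F K (y ^ 2) = 0) (hu : u ^ Fintype.card F ≠ u) :
    Algebra.trace F K (x * y) ≠ 0 := by
  intro h
  have := trace_mul_identity hK hy hx2 hy2
  rw [h, map_zero, mul_zero] at this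
  have h3 := pow_card_pow_card_ne hK hu
  exact mul_ne_zero (pow_ne_zero 2 hx) (mul_ne_zero h3 (pow_ne_zero _ h3)) this.symm

/-- In `trace_mul_identity` the right side is a square times $v\cdot v^q$, and $\eta(v^q)=\eta(v)$
as $q$ is odd. So $\eta(\mathrm{Tr}(xy))=\eta(u+u^q)=\eta(u)\,\eta(1+u^{q-1})$, while
$\eta(xy)=\eta(x^2u)=\eta(u)$. -/
theorem quadraticChar_trace_mul [DecidableEq K] (hodd : Odd (Fintype.card F))
    (hK : Module.finrank F K = 3) {x y u : K} (hx : x ≠ 0) (hu0 : u ≠ 0) (hy : y = x * u)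
    (hx2 : Algebra.trace F K (x ^ 2) = 0) (hy2 : Algebra.trace F K (y ^ 2) = 0)
    (hu : u ^ Fintype.card F ≠ u) :
    quadraticChar K (2 * (x * y) * algebraMap F K (Algebra.trace F K (x * y))) =
      quadraticChar K 2 * quadraticChar K (1 + u ^ (Fintype.card F - 1)) := by
  have h := congrArg (quadraticChar K) (trace_mul_identity hK hy hx2 hy2)
  have h3 := pow_card_pow_card_ne hK hu
  have hux : u + u ^ Fintype.card F = u * (1 + u ^ (Fintype.card F - 1)) := by
    rw [mul_add, mul_one, ← pow_succ', Nat.sub_add_cancel Fintype.card_pos]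
  have hT : algebraMap F K (Algebra.trace F K (x * y)) ≠ 0 := by
    rw [Ne, FaithfulSMul.algebraMap_eq_zero_iff]
    exact trace_mul_ne_zero hK hx hy hx2 hy2 hu
  simp only [map_mul, quadraticChar_pow_card hodd, quadraticChar_sq_one' hx] at h
  rw [← sq, quadraticChar_sq_one h3, hux, map_mul] at h
  have hT2 := quadraticChar_sq_one hT
  have hx2' := quadraticChar_sq_one hx
  have hu2 := quadraticChar_sq_one hu0
  rw [hy]
  rw [hy] at h hT2
  simp only [map_mul]
  set t := quadraticChar K (algebraMap F K (Algebra.trace F K (x * (x * u))))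
  set a := quadraticChar K x
  set b := quadraticChar K u
  set c := quadraticChar K 2
  set e := quadraticChar K (1 + u ^ (Fintype.card F - 1))
  linear_combination (c * t * b) * hx2' + c * t * b * (-h) + c * e * b ^ 2 * hT2 + c * e * hu2

/-- The Gram determinant of three points on the conic is a nonzero square. -/
theorem quadraticChar_gram [DecidableEq K] (hK : Module.finrank F K = 3) (h2 : (2 : K) ≠ 0)
    {x y z : K}
    (hx : Algebra.trace F K (x ^ 2) = 0) (hy : Algebra.trace F K (y ^ 2) = 0)
    (hz : Algebra.trace F K (z ^ 2) = 0) (hxy : Algebra.trace F K (x * y) ≠ 0)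
    (hyz : Algebra.trace F K (z * y) ≠ 0) (hxz : Algebra.trace F K (z * x) ≠ 0) :
    quadraticChar K (2 * algebraMap F K (Algebra.trace F K (x * y)) *
      algebraMap F K (Algebra.trace F K (z * y)) *
      algebraMap F K (Algebra.trace F K (z * x))) = 1 := by
  have key : ∃ δ : K, 2 * algebraMap F K (Algebra.trace F K (x * y)) *
      algebraMap F K (Algebra.trace F K (z * y)) *
      algebraMap F K (Algebra.trace F K (z * x)) = δ ^ 2 := by
    have h1 := algebraMap_trace_eq hK (x ^ 2)
    have h2 := algebraMap_trace_eq hK (y ^ 2)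
    have h3 := algebraMap_trace_eq hK (z ^ 2)
    have h4 := algebraMap_trace_eq hK (x * y)
    have h5 := algebraMap_trace_eq hK (z * y)
    have h6 := algebraMap_trace_eq hK (z * x)
    rw [hx, map_zero] at h1
    rw [hy, map_zero] at h2
    rw [hz, map_zero] at h3
    simp only [mul_pow, fun a : K => pow_right_comm a 2 (Fintype.card F)] at h1 h2 h3 h4 h5 h6
    set x₁ := x ^ Fintype.card F
    set x₂ := x₁ ^ Fintype.card F
    set y₁ := y ^ Fintype.card F
    set y₂ := y₁ ^ Fintype.card F
    set z₁ := z ^ Fintype.card F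
    set z₂ := z₁ ^ Fintype.card F
    set a := algebraMap F K (Algebra.trace F K (x * y))
    set b := algebraMap F K (Algebra.trace F K (z * y))
    set c := algebraMap F K (Algebra.trace F K (z * x))
    -- $\delta$ is the determinant of the matrix $A$ whose rows are the conjugates of $x,y,z$; the
    -- Gram matrix is $AA^{T}$.
    refine ⟨x * (y₁ * z₂ - y₂ * z₁) - x₁ * (y * z₂ - y₂ * z) + x₂ * (y * z₁ - y₁ * z), ?_⟩
    rw [h4, h5, h6]
    linear_combination
      ((z * y + z₁ * y₁ + z₂ * y₂) ^ 2 -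
          (y ^ 2 + y₁ ^ 2 + y₂ ^ 2) * (z ^ 2 + z₁ ^ 2 + z₂ ^ 2)) * (-h1) +
        (z * x + z₁ * x₁ + z₂ * x₂) ^ 2 * (-h2) + (x * y + x₁ * y₁ + x₂ * y₂) ^ 2 * (-h3)
  obtain ⟨δ, hδ⟩ := key
  have hne : δ ^ 2 ≠ 0 := by
    rw [← hδ]
    refine mul_ne_zero (mul_ne_zero (mul_ne_zero h2 ?_) ?_) ?_ <;>
      rwa [Ne, FaithfulSMul.algebraMap_eq_zero_iff]
  rw [hδ]
  exact quadraticChar_sq_one' (fun h => hne (by rw [h]; simp))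

end Algebra

/-! ### Exponents of $\omega$ and the points they represent. -/

section Exponents

variable {F K : Type*} [Field F] [Fintype F] [Field K] [Fintype K] [Algebra F K] {ω : Kˣ}

theorem odd_numPoints (F : Type*) [Fintype F] : Odd (numPoints F) := by
  have h := Nat.even_mul_succ_self (Fintype.card F)
  have h' : numPoints F = Fintype.card F * (Fintype.card F + 1) + 1 := by
    unfold numPoints; ring
  rw [h']
  exact h.add_one

theorem card_sub_one_mul_numPoints (F : Type*) [Fintype F] [Nonempty F] :
    (Fintype.card F - 1) * numPoints F = Fintype.card F ^ 3 - 1 := by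
  obtain ⟨m, hm⟩ := Nat.exists_eq_succ_of_ne_zero (Fintype.card_ne_zero (α := F))
  unfold numPoints
  rw [hm]
  simp only [Nat.succ_eq_add_one, Nat.add_sub_cancel]
  have : (m + 1) ^ 3 = m * ((m + 1) ^ 2 + (m + 1) + 1) + 1 := by ring
  omega

theorem orderOf_primitive (hK : Module.finrank F K = 3) (hω : IsPrimitiveElement ω) :
    orderOf ω = (Fintype.card F - 1) * numPoints F := by
  classical
  rw [orderOf_eq_card_of_forall_mem_zpowers hω, Nat.card_eq_fintype_card, Fintype.card_units,
    Module.card_eq_pow_finrank (K := F) (V := K), hK, card_sub_one_mul_numPoints]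

theorem zpow_pow_card_sub_one_eq_one_iff (hK : Module.finrank F K = 3)
    (hω : IsPrimitiveElement ω) (k : ℤ) :
    ((ω ^ k : Kˣ) : K) ^ (Fintype.card F - 1) = 1 ↔ (numPoints F : ℤ) ∣ k := by
  have hq : ((Fintype.card F - 1 : ℕ) : ℤ) ≠ 0 := by
    have := Fintype.one_lt_card (α := F)
    omega
  rw [← Units.val_pow_eq_pow_val, Units.val_eq_one, ← zpow_natCast, ← zpow_mul,
    ← orderOf_dvd_iff_zpow_eq_one, orderOf_primitive hK hω, Nat.cast_mul, mul_comm k,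
    mul_dvd_mul_iff_left hq]

theorem zpow_pow_card_eq_iff (hK : Module.finrank F K = 3) (hω : IsPrimitiveElement ω) (k : ℤ) :
    ((ω ^ k : Kˣ) : K) ^ Fintype.card F = ((ω ^ k : Kˣ) : K) ↔ (numPoints F : ℤ) ∣ k := by
  rw [← zpow_pow_card_sub_one_eq_one_iff hK hω, ← Nat.sub_add_cancel
    (Fintype.card_pos (α := F)), pow_succ, Nat.add_sub_cancel]
  exact mul_eq_right₀ (Units.ne_zero _)

theorem exists_algebraMap_eq_zpow_iff (hK : Module.finrank F K = 3) (hω : IsPrimitiveElement ω)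
    (k : ℤ) : (∃ c : F, algebraMap F K c = ((ω ^ k : Kˣ) : K)) ↔ (numPoints F : ℤ) ∣ k := by
  rw [← zpow_pow_card_eq_iff hK hω]
  refine ⟨?_, exists_algebraMap_eq_of_pow_card_eq hK⟩
  rintro ⟨c, hc⟩
  rw [← hc, algebraMap_pow_card]

theorem trace_zpow_eq_zero_congr (hK : Module.finrank F K = 3) (hω : IsPrimitiveElement ω)
    {i j : ℤ} (h : (i : ZMod (numPoints F)) = j) (hi : Algebra.trace F K ((ω ^ i : Kˣ) : K) = 0) :
    Algebra.trace F K ((ω ^ j : Kˣ) : K) = 0 := by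
  rw [ZMod.intCast_eq_intCast_iff_dvd_sub] at h
  obtain ⟨c, hc⟩ := (exists_algebraMap_eq_zpow_iff hK hω _).2 h
  have : ((ω ^ j : Kˣ) : K) = c • ((ω ^ i : Kˣ) : K) := by
    rw [Algebra.smul_def, hc, ← Units.val_mul, ← zpow_add, sub_add_cancel]
  rw [this, map_smul, hi, smul_zero]

theorem intCast_mem_singerSet_iff (hK : Module.finrank F K = 3) (hω : IsPrimitiveElement ω)
    (i : ℤ) : (i : ZMod (numPoints F)) ∈ singerSet F ω ↔
      Algebra.trace F K ((ω ^ i : Kˣ) : K) = 0 := by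
  constructor
  · rintro ⟨j, hj, hji⟩
    exact trace_zpow_eq_zero_congr hK hω hji hj
  · exact fun h => ⟨i, h, rfl⟩

theorem intCast_mem_conicSet_iff (hK : Module.finrank F K = 3) (hω : IsPrimitiveElement ω)
    (i : ℤ) : (i : ZMod (numPoints F)) ∈ conicSet F ω ↔
      Algebra.trace F K (((ω ^ i : Kˣ) : K) ^ 2) = 0 := by
  have e : ∀ k : ℤ, ((ω ^ k : Kˣ) : K) ^ 2 = ((ω ^ (k * 2) : Kˣ) : K) := fun k => by
    rw [zpow_mul]; norm_cast
  constructor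
  · rintro ⟨j, hj, hji⟩
    rw [Set.mem_ofPred_eq, e] at hj
    rw [e]
    refine trace_zpow_eq_zero_congr hK hω ?_ hj
    simp only at hji
    push_cast
    rw [hji]
  · exact fun h => ⟨i, h, rfl⟩

theorem two_mul_mem_singerSet_iff (hK : Module.finrank F K = 3) (hω : IsPrimitiveElement ω)
    (i : ℤ) : ((2 * i : ℤ) : ZMod (numPoints F)) ∈ singerSet F ω ↔
      (i : ZMod (numPoints F)) ∈ conicSet F ω := by
  rw [intCast_mem_singerSet_iff hK hω, intCast_mem_conicSet_iff hK hω, mul_comm, zpow_mul]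
  norm_cast

theorem quadraticChar_zpow_eq_one_iff [DecidableEq K] (hK : ringChar K ≠ 2)
    (hω : IsPrimitiveElement ω) (k : ℤ) :
    quadraticChar K ((ω ^ k : Kˣ) : K) = 1 ↔ Even k := by
  have hω1 : quadraticChar K (ω : K) = -1 := by
    refine (quadraticChar_dichotomy ω.ne_zero).resolve_left fun h => ?_
    -- If $\omega$ were a square, so would be every power of it, including this nonsquare.
    obtain ⟨a, ha⟩ := quadraticChar_exists_neg_one hK
    have ha0 : a ≠ 0 := by rintro rfl; simp at ha
    obtain ⟨s, hs⟩ := (quadraticChar_one_iff_isSquare ω.ne_zero).1 h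
    obtain ⟨j, hj⟩ := hω (Units.mk0 a ha0)
    have hs0 : s ≠ 0 := by rintro rfl; simp at hs
    have h' : a = (((Units.mk0 s hs0) ^ j : Kˣ) : K) ^ 2 := by
      have : ω = Units.mk0 s hs0 ^ 2 := by ext; simp [hs, sq]
      have h2 : a = ((ω ^ j : Kˣ) : K) := by simp only at hj; rw [hj]; rfl
      rw [h2, this, ← Units.val_pow_eq_pow_val, ← zpow_natCast, ← zpow_mul, ← zpow_natCast,
        ← zpow_mul, mul_comm]
    rw [h', quadraticChar_sq_one' (Units.ne_zero _)] at ha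
    norm_num at ha
  rcases Int.even_or_odd' k with ⟨m, rfl | rfl⟩
  · have : ((ω ^ (2 * m) : Kˣ) : K) = ((ω ^ m : Kˣ) : K) ^ 2 := by
      rw [mul_comm, zpow_mul]; norm_cast
    rw [this, quadraticChar_sq_one' (Units.ne_zero _)]
    simp
  · have : ((ω ^ (2 * m + 1) : Kˣ) : K) = ((ω ^ m : Kˣ) : K) ^ 2 * ω := by
      rw [zpow_add, mul_comm 2, zpow_mul]; norm_cast; simp
    rw [this, map_mul, quadraticChar_sq_one' (Units.ne_zero _), hω1]
    constructor
    · intro h; norm_num at h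
    · intro h; exact absurd h (by simp)

/-- An element of `K*` can be scaled by `F*` to become an even power of `ω`. -/
theorem exists_smul_eq_zpow_two_mul (hK : Module.finrank F K = 3)
    (hω : IsPrimitiveElement ω) {w : K} (hw : w ≠ 0) :
    ∃ (i : ℤ) (c : F), c • w = ((ω ^ (2 * i) : Kˣ) : K) := by
  obtain ⟨j, hj⟩ := hω (Units.mk0 w hw)
  have hj' : w = ((ω ^ j : Kˣ) : K) := by simp only at hj; rw [hj]; rfl
  rcases Int.even_or_odd' j with ⟨m, rfl | rfl⟩
  · exact ⟨m, 1, by rw [one_smul, hj']⟩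
  -- The scalar is $\omega^n\in\mathbb F_q^*$; as $n$ is odd, it corrects the parity of the
  -- exponent.
  · obtain ⟨c, hc⟩ := (exists_algebraMap_eq_zpow_iff hK hω (numPoints F)).2 dvd_rfl
    obtain ⟨t, ht⟩ := odd_numPoints F
    refine ⟨m + t + 1, c, ?_⟩
    rw [Algebra.smul_def, hc, hj', ← Units.val_mul, ← zpow_add]
    congr 2
    rw [ht]; push_cast; ring

/-- For every `u` representing a nontrivial point there are points `x` and `xu` of the conic. -/
theorem exists_conic_pair (hK : Module.finrank F K = 3) (hω : IsPrimitiveElement ω) {u : K}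
    (hu : (u ^ 2) ^ Fintype.card F ≠ u ^ 2) :
    ∃ i : ℤ, Algebra.trace F K (((ω ^ i : Kˣ) : K) ^ 2) = 0 ∧
      Algebra.trace F K ((((ω ^ i : Kˣ) : K) * u) ^ 2) = 0 := by
  obtain ⟨q, hq⟩ : ∃ q, q = Fintype.card F := ⟨_, rfl⟩
  obtain ⟨U, hU⟩ : ∃ U, U = u ^ 2 := ⟨_, rfl⟩
  rw [← hU, ← hq] at hu
  have h3 : ((U ^ q) ^ q) ^ q = U := hq ▸ pow_card_pow_card_pow_card hK U
  have hs (a b : K) : (a - b) ^ q = a ^ q - b ^ q := hq ▸ sub_pow_card_base a b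
  -- The square of the sought point must be orthogonal to $1$ and to $U$ under the trace form; the
  -- cross product of their vectors of conjugates gives $U^{q^2}-U^q$. Scaling then makes it a
  -- square.
  have hw : (U ^ q) ^ q - U ^ q ≠ 0 := by
    intro h
    apply hu
    have := congrArg (fun x : K => (x ^ q) ^ q) (sub_eq_zero.1 h)
    simp only [h3] at this
    exact this
  obtain ⟨i, c, hc⟩ := exists_smul_eq_zpow_two_mul hK hω hw
  have e : ((ω ^ i : Kˣ) : K) ^ 2 = c • ((U ^ q) ^ q - U ^ q) := by
    rw [hc, mul_comm, zpow_mul]; norm_cast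
  have hinj := (algebraMap F K).injective
  refine ⟨i, ?_, ?_⟩
  · rw [e, map_smul]
    convert smul_zero c
    apply hinj
    rw [algebraMap_trace_eq hK, map_zero, ← hq]
    simp only [hs, h3]
    ring
  · rw [mul_pow, ← hU, e, smul_mul_assoc, map_smul]
    convert smul_zero c
    apply hinj
    rw [algebraMap_trace_eq hK, map_zero, ← hq]
    simp only [mul_pow, hs, h3]
    ring

end Exponents

/-! ### Consequences of the arc hypothesis. -/

section Arc

variable {F K : Type*} [Field F] [Fintype F] [Field K] [Fintype K] [Algebra F K] {ω : Kˣ}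

theorem mk_zpow_eq_mk_zpow_iff (hK : Module.finrank F K = 3) (hω : IsPrimitiveElement ω)
    (i j : ℤ) :
    Projectivization.mk F ((ω ^ i : Kˣ) : K) (Units.ne_zero _) =
      Projectivization.mk F ((ω ^ j : Kˣ) : K) (Units.ne_zero _) ↔
        (i : ZMod (numPoints F)) = j := by
  rw [Projectivization.mk_eq_mk_iff', eq_comm (a := (i : ZMod (numPoints F))),
    ZMod.intCast_eq_intCast_iff_dvd_sub, ← exists_algebraMap_eq_zpow_iff hK hω]
  refine exists_congr fun c => ?_
  rw [Algebra.smul_def, zpow_sub, Units.val_mul, Units.val_inv_eq_inv_val,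
    eq_mul_inv_iff_mul_eq₀ (Units.ne_zero _)]

/-- If `C₀ / F*` is an arc then every class modulo `N` contains at most two elements of the
Singer difference set. -/
theorem IsArc.singerSet_class (hK : Module.finrank F K = 3) (hω : IsPrimitiveElement ω)
    {M N : ℕ} (harc : IsArc M (cyclotomicPoints F ω N)) {a b c : ℤ}
    (ha : Algebra.trace F K ((ω ^ a : Kˣ) : K) = 0)
    (hb : Algebra.trace F K ((ω ^ b : Kˣ) : K) = 0)
    (hc : Algebra.trace F K ((ω ^ c : Kˣ) : K) = 0)
    (hba : (N : ℤ) ∣ b - a) (hca : (N : ℤ) ∣ c - a)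
    (hab : (a : ZMod (numPoints F)) ≠ b) (hac : (a : ZMod (numPoints F)) ≠ c)
    (hbc : (b : ZMod (numPoints F)) ≠ c) : False := by
  have : FiniteDimensional F K := Module.finite_of_finrank_pos (by omega)
  have hmem : ∀ k : ℤ, (N : ℤ) ∣ k → Projectivization.mk F ((ω ^ k : Kˣ) : K)
      (Units.ne_zero _) ∈ cyclotomicPoints F ω N := by
    rintro k ⟨t, rfl⟩
    exact ⟨ω ^ ((N : ℤ) * t), ⟨t, by simp only [zpow_mul, zpow_natCast]⟩, rfl⟩
  refine harc.2 _ (hmem 0 (dvd_zero _)) _ (hmem _ hba) _ (hmem _ hca) ?_ ?_ ?_ ?_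
  · rw [Ne, mk_zpow_eq_mk_zpow_iff hK hω]
    push_cast
    exact fun h => hab (sub_eq_zero.1 h.symm).symm
  · rw [Ne, mk_zpow_eq_mk_zpow_iff hK hω]
    push_cast
    exact fun h => hac (sub_eq_zero.1 h.symm).symm
  · rw [Ne, mk_zpow_eq_mk_zpow_iff hK hω]
    push_cast
    exact fun h => hbc (sub_left_injective h)
  -- After division by $\omega^a$ the three points lie in $C_0/\mathbb F_q^*$ and on the line
  -- $\mathrm{Tr}(\omega^a x)=0$.
  · let f : Module.Dual F K :=
      (Algebra.trace F K).comp (LinearMap.mulLeft F ((ω ^ a : Kˣ) : K))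
    have hf : f ≠ 0 := by
      obtain ⟨e, he⟩ := Algebra.trace_surjective F K 1
      intro h
      have := LinearMap.congr_fun h (((ω ^ a : Kˣ) : K)⁻¹ * e)
      simp only [f, LinearMap.comp_apply, LinearMap.mulLeft_apply,
        mul_inv_cancel_left₀ (Units.ne_zero (ω ^ a)), he] at this
      simp at this
    have hle : ∀ k : ℤ, Algebra.trace F K ((ω ^ k : Kˣ) : K) = 0 →
        (Projectivization.mk F ((ω ^ (k - a) : Kˣ) : K) (Units.ne_zero _)).submodule ≤
          LinearMap.ker f := by
      intro k hk
      rw [Projectivization.submodule_mk, Submodule.span_singleton_le_iff_mem, LinearMap.mem_ker]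
      simp only [f, LinearMap.comp_apply, LinearMap.mulLeft_apply]
      rw [← Units.val_mul, ← zpow_add, add_sub_cancel, hk]
    refine ⟨LinearMap.ker f, ?_, ?_, hle b hb, hle c hc⟩
    · have := Module.Dual.finrank_ker_add_one_of_ne_zero hf
      omega
    · have := hle a ha
      simpa only [sub_self] using this

theorem isUnit_two_zmod {m : ℕ} (hm : Odd m) : IsUnit (2 : ZMod m) := by
  have := (ZMod.isUnit_iff_coprime 2 m).2 (Nat.coprime_two_left.2 hm)
  simpa using this

/-- Doubling carries $W$ into $S$ injectively, so $2i$ and $2j$ are two elements of $S$ in one class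
modulo $N$, and the arc forbids a third. -/
theorem mem_halfI₁_of_pair (hK : Module.finrank F K = 3) (hω : IsPrimitiveElement ω)
    {M N : ℕ} (hN : N ∣ numPoints F) (harc : IsArc M (cyclotomicPoints F ω N)) {i j : ℤ}
    (hi : (i : ZMod (numPoints F)) ∈ conicSet F ω) (hj : (j : ZMod (numPoints F)) ∈ conicSet F ω)
    (hij : (i : ZMod (numPoints F)) ≠ j) (hmod : (i : ZMod N) = j) :
    (i : ZMod N) ∈ halfI₁ F ω N := by
  have h2n := isUnit_two_zmod (odd_numPoints F)
  have h2N := isUnit_two_zmod ((odd_numPoints F).of_dvd_nat hN)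
  have hne : ((2 * i : ℤ) : ZMod (numPoints F)) ≠ (2 * j : ℤ) := by
    push_cast
    exact fun h => hij (h2n.mul_left_cancel h)
  have hmod' : ((2 * i : ℤ) : ZMod N) = (2 * j : ℤ) := by push_cast; rw [hmod]
  have hi' := (two_mul_mem_singerSet_iff hK hω i).2 hi
  have hj' := (two_mul_mem_singerSet_iff hK hω j).2 hj
  refine ⟨((2 * i : ℤ) : ZMod N), ?_, ?_⟩
  · change singerMult F ω N _ = 2
    rw [singerMult, Set.ncard_eq_two]
    refine ⟨_, _, hne, ?_⟩
    ext s
    simp only [Set.mem_ofPred_eq, Set.mem_insert_iff, Set.mem_singleton_iff]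
    constructor
    · rintro ⟨hs, hsN⟩
      obtain ⟨k, rfl⟩ := ZMod.intCast_surjective s
      rw [ZMod.cast_intCast hN] at hsN
      by_contra! hcon
      rw [intCast_mem_singerSet_iff hK hω] at hs hi' hj'
      refine harc.singerSet_class hK hω hi' hj' hs ?_ ?_ hne hcon.1.symm hcon.2.symm
      · rwa [← ZMod.intCast_eq_intCast_iff_dvd_sub]
      · rw [← ZMod.intCast_eq_intCast_iff_dvd_sub]; exact hsN.symm
    · rintro (rfl | rfl)
      · exact ⟨hi', ZMod.cast_intCast hN _⟩
      · exact ⟨hj', (ZMod.cast_intCast hN _).trans hmod'.symm⟩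
  · push_cast
    rw [← mul_assoc, ZMod.inv_mul_of_unit _ h2N, one_mul]

end Arc

/-! ### Logarithms of the elements of $\mathcal X$ and their parities. -/

section Logarithms

variable {F K : Type*} [Field F] [Fintype F] [Field K] [Fintype K] [Algebra F K]
  {ω : Kˣ} {r : ZMod (numPoints F) → ℤ} {d₀ : ZMod (numPoints F)}

theorem trace_rep_sq (hK : Module.finrank F K = 3) (hω : IsPrimitiveElement ω)
    (hr : ∀ i, (r i : ZMod (numPoints F)) = i) {d : ZMod (numPoints F)}
    (hd : d ∈ conicSet F ω) : Algebra.trace F K (((ω ^ r d : Kˣ) : K) ^ 2) = 0 := by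
  rw [← intCast_mem_conicSet_iff hK hω, hr]
  exact hd

theorem not_dvd_rep_sub {F : Type*} [Fintype F] {r : ZMod (numPoints F) → ℤ}
    (hr : ∀ i, (r i : ZMod (numPoints F)) = i) {d d' : ZMod (numPoints F)}
    (hne : d ≠ d') : ¬ (numPoints F : ℤ) ∣ r d' - r d := by
  rwa [← ZMod.intCast_eq_intCast_iff_dvd_sub, hr, hr]

theorem zpow_eq_zpow_mul_zpow_sub {K : Type*} [Field K] {ω : Kˣ} (i j : ℤ) :
    ((ω ^ j : Kˣ) : K) = ((ω ^ i : Kˣ) : K) * ((ω ^ (j - i) : Kˣ) : K) := by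
  rw [← Units.val_mul, ← zpow_add, add_sub_cancel]

theorem trace_rep_mul_ne_zero (hK : Module.finrank F K = 3) (hω : IsPrimitiveElement ω)
    (hr : ∀ i, (r i : ZMod (numPoints F)) = i) {d d' : ZMod (numPoints F)}
    (hd : d ∈ conicSet F ω) (hd' : d' ∈ conicSet F ω) (hne : d ≠ d') :
    Algebra.trace F K (((ω ^ r d : Kˣ) : K) * ((ω ^ r d' : Kˣ) : K)) ≠ 0 :=
  trace_mul_ne_zero hK (Units.ne_zero _) (zpow_eq_zpow_mul_zpow_sub _ _)
    (trace_rep_sq hK hω hr hd) (trace_rep_sq hK hω hr hd')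
    (mt (zpow_pow_card_eq_iff hK hω _).1 (not_dvd_rep_sub hr hne))

theorem intCast_eq_of_zpow_eq_mul (hK : Module.finrank F K = 3) (hω : IsPrimitiveElement ω)
    {k i : ℤ} {c : F} (h : ((ω ^ k : Kˣ) : K) = ((ω ^ i : Kˣ) : K) * algebraMap F K c) :
    (k : ZMod (numPoints F)) = i := by
  rw [eq_comm, ZMod.intCast_eq_intCast_iff_dvd_sub, ← exists_algebraMap_eq_zpow_iff hK hω]
  refine ⟨c, ?_⟩
  rw [zpow_eq_zpow_mul_zpow_sub i k] at h
  exact (mul_left_cancel₀ (Units.ne_zero _) h).symm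

theorem zpow_mem_conicElements (hK : Module.finrank F K = 3) (hω : IsPrimitiveElement ω)
    (hr : ∀ i, (r i : ZMod (numPoints F)) = i) {k : ℤ}
    (hk : ((ω ^ k : Kˣ) : K) ∈ conicElements F ω r d₀) :
    ((k : ZMod (numPoints F)) ∈ conicSet F ω ∧ (k : ZMod (numPoints F)) ≠ d₀ ∧
      ((ω ^ k : Kˣ) : K) = ((ω ^ r k : Kˣ) : K) * algebraMap F K (Algebra.trace F K
        (((ω ^ r d₀ : Kˣ) : K) * ((ω ^ r k : Kˣ) : K)))) ∨
    ((k : ZMod (numPoints F)) = d₀ ∧ ((ω ^ k : Kˣ) : K) = 2 * ((ω ^ r d₀ : Kˣ) : K)) := by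
  rcases hk with ⟨d, hd, hne, h⟩ | h
  · have := intCast_eq_of_zpow_eq_mul hK hω h
    rw [hr] at this
    subst this
    rw [zpow_add, Units.val_mul] at h
    exact Or.inl ⟨hd, hne, h⟩
  · rw [Set.mem_singleton_iff] at h
    refine Or.inr ⟨?_, h⟩
    have h' : ((ω ^ k : Kˣ) : K) = ((ω ^ r d₀ : Kˣ) : K) * algebraMap F K 2 := by
      rw [h, map_ofNat, mul_comm]
    rw [intCast_eq_of_zpow_eq_mul hK hω h', hr]

theorem exists_zpow_mem_conicElements (hodd : Odd (Fintype.card F))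
    (hK : Module.finrank F K = 3) (hω : IsPrimitiveElement ω)
    (hr : ∀ i, (r i : ZMod (numPoints F)) = i) (hd₀ : d₀ ∈ conicSet F ω)
    {d : ZMod (numPoints F)} (hd : d ∈ conicSet F ω) :
    ∃ k : ℤ, ((ω ^ k : Kˣ) : K) ∈ conicElements F ω r d₀ ∧ (k : ZMod (numPoints F)) = d := by
  have hlog : ∀ x : K, x ≠ 0 → ∃ k : ℤ, ((ω ^ k : Kˣ) : K) = x := fun x hx => by
    obtain ⟨k, hk⟩ := hω (Units.mk0 x hx)
    exact ⟨k, congrArg Units.val hk⟩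
  by_cases h : d = d₀
  · obtain ⟨k, hk⟩ := hlog (2 * ((ω ^ r d₀ : Kˣ) : K))
      (mul_ne_zero (two_ne_zero_of_odd_card (F := F) hodd) (Units.ne_zero _))
    refine ⟨k, Or.inr hk, ?_⟩
    have h' : ((ω ^ k : Kˣ) : K) = ((ω ^ r d₀ : Kˣ) : K) * algebraMap F K 2 := by
      rw [hk, map_ofNat, mul_comm]
    rw [intCast_eq_of_zpow_eq_mul hK hω h', hr, h]
  · obtain ⟨k, hk⟩ := hlog (((ω ^ r d : Kˣ) : K) * algebraMap F K (Algebra.trace F K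
        ((ω ^ (r d₀ + r d) : Kˣ) : K))) (by
      refine mul_ne_zero (Units.ne_zero _) ?_
      rw [Ne, FaithfulSMul.algebraMap_eq_zero_iff, zpow_add, Units.val_mul]
      exact trace_rep_mul_ne_zero hK hω hr hd₀ hd (Ne.symm h))
    exact ⟨k, Or.inl ⟨d, hd, h, hk⟩, (intCast_eq_of_zpow_eq_mul hK hω hk).trans (hr d)⟩

theorem conicSet_of_zpow_mem_conicElements (hK : Module.finrank F K = 3)
    (hω : IsPrimitiveElement ω) (hr : ∀ i, (r i : ZMod (numPoints F)) = i)
    (hd₀ : d₀ ∈ conicSet F ω) {k : ℤ} (hk : ((ω ^ k : Kˣ) : K) ∈ conicElements F ω r d₀) :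
    (k : ZMod (numPoints F)) ∈ conicSet F ω := by
  rcases zpow_mem_conicElements hK hω hr hk with h | h
  · exact h.1
  · rw [h.1]; exact hd₀

/-- The quadratic character of a product of two of the `conicElements` does not depend on the
base point `d₀`. -/
theorem quadraticChar_zpow_add [DecidableEq K] (hodd : Odd (Fintype.card F))
    (hK : Module.finrank F K = 3)
    (hω : IsPrimitiveElement ω) (hr : ∀ i, (r i : ZMod (numPoints F)) = i)
    (hd₀ : d₀ ∈ conicSet F ω) {k k' : ℤ}
    (hk : ((ω ^ k : Kˣ) : K) ∈ conicElements F ω r d₀)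
    (hk' : ((ω ^ k' : Kˣ) : K) ∈ conicElements F ω r d₀)
    (hne : (k : ZMod (numPoints F)) ≠ k') :
    quadraticChar K ((ω ^ (k + k') : Kˣ) : K) =
      quadraticChar K (2 * (((ω ^ r k : Kˣ) : K) * ((ω ^ r k' : Kˣ) : K)) *
        algebraMap F K (Algebra.trace F K
          (((ω ^ r k : Kˣ) : K) * ((ω ^ r k' : Kˣ) : K)))) := by
  have h2 : (2 : K) ≠ 0 := two_ne_zero_of_odd_card (F := F) hodd
  have hd := conicSet_of_zpow_mem_conicElements hK hω hr hd₀ hk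
  have hd' := conicSet_of_zpow_mem_conicElements hK hω hr hd₀ hk'
  rw [zpow_add, Units.val_mul]
  rcases zpow_mem_conicElements hK hω hr hk with ⟨-, h1, h⟩ | ⟨h1, h⟩ <;>
    rcases zpow_mem_conicElements hK hω hr hk' with ⟨-, h1', h'⟩ | ⟨h1', h'⟩
  -- Neither point is the base point: the Gram relation for $d_0,d,d'$ replaces the two traces
  -- against $d_0$ by $2\,\mathrm{Tr}(xy)$, up to squares.
  · rw [h, h']
    have hT := trace_rep_mul_ne_zero hK hω hr hd hd' hne
    have hg := quadraticChar_gram hK h2 (trace_rep_sq hK hω hr hd) (trace_rep_sq hK hω hr hd')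
      (trace_rep_sq hK hω hr hd₀) hT (trace_rep_mul_ne_zero hK hω hr hd₀ hd' h1'.symm)
      (trace_rep_mul_ne_zero hK hω hr hd₀ hd h1.symm)
    have hT2 := quadraticChar_sq_one
      ((FaithfulSMul.algebraMap_eq_zero_iff F K).not.2 hT)
    have h22 := quadraticChar_sq_one h2
    rw [map_mul, map_mul, map_mul] at hg
    simp only [map_mul (quadraticChar K) _ (algebraMap F K _), map_mul (quadraticChar K) 2,
      map_mul (quadraticChar K) ((ω ^ r (k : ZMod (numPoints F)) : Kˣ) : K),
      map_mul (quadraticChar K) (_ * algebraMap F K _)]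
    generalize quadraticChar K (algebraMap F K (Algebra.trace F K
      (((ω ^ r k : Kˣ) : K) * ((ω ^ r k' : Kˣ) : K)))) = t at hg hT2 ⊢
    generalize quadraticChar K (algebraMap F K (Algebra.trace F K
      (((ω ^ r d₀ : Kˣ) : K) * ((ω ^ r k' : Kˣ) : K)))) = b at hg ⊢
    generalize quadraticChar K (algebraMap F K (Algebra.trace F K
      (((ω ^ r d₀ : Kˣ) : K) * ((ω ^ r k : Kˣ) : K)))) = a at hg ⊢
    generalize quadraticChar K ((ω ^ r k : Kˣ) : K) = x
    generalize quadraticChar K ((ω ^ r k' : Kˣ) : K) = y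
    generalize quadraticChar K (2 : K) = c at hg h22 ⊢
    linear_combination x * y * c * t * hg - x * y * a * b * t ^ 2 * h22 - x * y * a * b * hT2
  -- With one point equal to $d_0$ the two products agree literally; this is what the factor 2 in
  -- $2\omega^{d_0}$ is for.
  · rw [h, h', h1', mul_comm ((ω ^ r d₀ : Kˣ) : K)]
    congr 1; ring
  · rw [h, h', h1]
    congr 1; ring
  · exact absurd (h1.trans h1'.symm) hne

theorem even_add_iff [DecidableEq K] (hodd : Odd (Fintype.card F)) (hK : Module.finrank F K = 3)
    (hω : IsPrimitiveElement ω) (hr : ∀ i, (r i : ZMod (numPoints F)) = i)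
    (hd₀ : d₀ ∈ conicSet F ω) {k k' : ℤ}
    (hk : ((ω ^ k : Kˣ) : K) ∈ conicElements F ω r d₀)
    (hk' : ((ω ^ k' : Kˣ) : K) ∈ conicElements F ω r d₀)
    (hne : (k : ZMod (numPoints F)) ≠ k') :
    Even (k + k') ↔ quadraticChar K 2 *
      quadraticChar K (1 + ((ω ^ (k' - k) : Kˣ) : K) ^ (Fintype.card F - 1)) = 1 := by
  have hd := conicSet_of_zpow_mem_conicElements hK hω hr hd₀ hk
  have hd' := conicSet_of_zpow_mem_conicElements hK hω hr hd₀ hk'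
  rw [← quadraticChar_zpow_eq_one_iff (ringChar_ne_two hodd) hω,
    quadraticChar_zpow_add hodd hK hω hr hd₀ hk hk' hne,
    quadraticChar_trace_mul hodd hK (Units.ne_zero _) (Units.ne_zero _)
      (zpow_eq_zpow_mul_zpow_sub _ _) (trace_rep_sq hK hω hr hd) (trace_rep_sq hK hω hr hd')
      (mt (zpow_pow_card_eq_iff hK hω _).1 (not_dvd_rep_sub hr hne))]
  -- Changing an exponent by a multiple of $n$ multiplies by an element of $\mathbb F_q^*$, which
  -- the $(q-1)$st power kills.
  have hdvd : (numPoints F : ℤ) ∣ r k' - r k - (k' - k) := by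
    rw [← ZMod.intCast_eq_intCast_iff_dvd_sub]
    push_cast
    rw [hr, hr]
  rw [zpow_eq_zpow_mul_zpow_sub (k' - k) (r k' - r k), mul_pow,
    (zpow_pow_card_sub_one_eq_one_iff hK hω _).2 hdvd, mul_one]

/-- If $u^{q-1}=-1$ then $u^2$ lies in $\mathbb F_q^*$, and $u$ does too because $n$ is odd. Thus
$\eta$ takes only the values $\pm1$ where it is compared with $\eta(2)$. -/
theorem one_add_zpow_pow_ne_zero (hK : Module.finrank F K = 3)
    (hω : IsPrimitiveElement ω) {s : ℤ} (hs : ¬ (numPoints F : ℤ) ∣ s) :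
    1 + ((ω ^ s : Kˣ) : K) ^ (Fintype.card F - 1) ≠ 0 := by
  intro h
  apply hs
  have h1 : ((ω ^ (s * 2) : Kˣ) : K) ^ (Fintype.card F - 1) = 1 := by
    have e : ((ω ^ (s * 2) : Kˣ) : K) = ((ω ^ s : Kˣ) : K) ^ 2 := by rw [zpow_mul]; norm_cast
    rw [e, pow_right_comm, eq_neg_of_add_eq_zero_right h]
    norm_num
  rw [zpow_pow_card_sub_one_eq_one_iff hK hω] at h1
  refine IsCoprime.dvd_of_dvd_mul_right ?_ h1
  rw [Int.isCoprime_iff_gcd_eq_one]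
  exact Nat.coprime_two_right.2 (odd_numPoints F)

end Logarithms

/-! ### Reduction modulo $2N$ and the range of $\ell$. -/

section Reduction

variable {F K : Type*} [Field F] [Fintype F] [Field K] [Algebra F K]
  {ω : Kˣ} {r : ZMod (numPoints F) → ℤ} {d₀ : ZMod (numPoints F)}

/-- `X₁` is purely a subset iff the reduction modulo `2N` is injective on the relevant
discrete logarithms. -/
theorem isPurelySubset_X₁_iff {N : ℕ} (hN : N ∣ numPoints F) :
    IsPurelySubset (X₁ F ω N r d₀) ↔ ∀ k k' : ℤ,
      ((ω ^ k : Kˣ) : K) ∈ conicElements F ω r d₀ →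
      ((ω ^ k' : Kˣ) : K) ∈ conicElements F ω r d₀ →
      (k : ZMod N) ∈ halfI₁ F ω N → (k' : ZMod N) ∈ halfI₁ F ω N →
      (k : ZMod (2 * N)) = k' → (k : ZMod (2 * numPoints F)) = k' := by
  classical
  have h1 : N ∣ 2 * numPoints F := hN.mul_left 2
  have h2 : 2 * N ∣ 2 * numPoints F := mul_dvd_mul_left 2 hN
  have : IsPurelySubset (X₁ F ω N r d₀) ↔ (X₁ F ω N r d₀).Nodup := by
    rw [Multiset.nodup_iff_count_le_one]
    unfold IsPurelySubset
    refine forall_congr' fun g => ?_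
    convert Iff.rfl
  rw [this, X₁, Multiset.nodup_map_iff_inj_on (Finset.nodup _)]
  simp only [Finset.mem_val, Finset.mem_filter, Finset.mem_univ, true_and]
  constructor
  · intro H k k' hk hk' hI hI' hkk
    refine H k ⟨⟨k, hk, rfl⟩, ?_⟩ k' ⟨⟨k', hk', rfl⟩, ?_⟩ ?_
    · rwa [ZMod.cast_intCast h1]
    · rwa [ZMod.cast_intCast h1]
    · rwa [ZMod.cast_intCast h2, ZMod.cast_intCast h2]
  · rintro H _ ⟨⟨k, hk, rfl⟩, hI⟩ _ ⟨⟨k', hk', rfl⟩, hI'⟩ hkk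
    simp only [ZMod.cast_intCast h1] at hI hI'
    simp only [ZMod.cast_intCast h2] at hkk
    exact H k k' hk hk' hI hI' hkk

theorem intCast_eq_of_two_mul {m : ℕ} {k k' : ℤ} (h : (k : ZMod (2 * m)) = k') :
    (k : ZMod m) = k' ∧ Even (k + k') := by
  rw [ZMod.intCast_eq_intCast_iff_dvd_sub] at h
  push_cast at h
  refine ⟨?_, ?_⟩
  · rw [ZMod.intCast_eq_intCast_iff_dvd_sub]
    exact (Dvd.intro_left 2 rfl).trans h
  · have := (Dvd.intro (m : ℤ) rfl).trans h
    rw [← even_iff_two_dvd, Int.even_sub] at this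
    rw [Int.even_add]
    exact this.symm

theorem intCast_two_mul_eq {m : ℕ} (hm : Odd m) {k k' : ℤ} (h : (k : ZMod m) = k')
    (heven : Even (k + k')) : (k : ZMod (2 * m)) = k' := by
  rw [ZMod.intCast_eq_intCast_iff_dvd_sub] at h ⊢
  push_cast
  refine IsCoprime.mul_dvd ?_ ?_ h
  · rw [Int.isCoprime_iff_gcd_eq_one]
    exact Nat.coprime_two_left.2 hm
  · rw [← even_iff_two_dvd, Int.even_sub]
    rw [Int.even_add] at heven
    exact heven.symm

/-- The natural-number division is exact, since $q^3-1=(q-1)MN$. -/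
theorem pow_mul_card_cube_sub_one_div {F K : Type*} [Field F] [Fintype F] [Field K] {ω : Kˣ}
    {M N : ℕ} (hM : 0 < M) (hMN : M * N = numPoints F) (l : ℕ) :
    (ω : K) ^ (l * (Fintype.card F ^ 3 - 1) / M) =
      ((ω ^ ((N * l : ℕ) : ℤ) : Kˣ) : K) ^ (Fintype.card F - 1) := by
  have : l * (Fintype.card F ^ 3 - 1) / M = N * l * (Fintype.card F - 1) := by
    rw [← card_sub_one_mul_numPoints, ← hMN]
    refine Nat.div_eq_of_eq_mul_right hM ?_
    ring
  rw [this, pow_mul, zpow_natCast, Units.val_pow_eq_pow_val]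

/-- The `q - 1`st power of a representative of a nontrivial point of `C₀ / F*` is that of some
`ω ^ (N l)` with `0 < l < M`. -/
theorem exists_zpow_pow_card_sub_one_eq [Fintype K] (hK : Module.finrank F K = 3)
    (hω : IsPrimitiveElement ω) {M N : ℕ} (hM : 0 < M) (hMN : M * N = numPoints F) {s : ℤ}
    (hN : (N : ℤ) ∣ s) (hs : ¬ (numPoints F : ℤ) ∣ s) :
    ∃ l : ℕ, 1 ≤ l ∧ l ≤ M - 1 ∧ ((ω ^ s : Kˣ) : K) ^ (Fintype.card F - 1) =
      ((ω ^ ((N * l : ℕ) : ℤ) : Kˣ) : K) ^ (Fintype.card F - 1) := by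
  obtain ⟨t, rfl⟩ := hN
  have hM' : (M : ℤ) ≠ 0 := by exact_mod_cast hM.ne'
  have h0 := Int.emod_nonneg t hM'
  have h1 := Int.emod_lt_of_pos t (b := (M : ℤ)) (by exact_mod_cast hM)
  obtain ⟨l, hl⟩ := Int.eq_ofNat_of_zero_le h0
  have ht := Int.emod_add_mul_ediv t M
  have hMN' : (M : ℤ) * N = numPoints F := by exact_mod_cast hMN
  refine ⟨l, ?_, by omega, ?_⟩
  · by_contra! hl0
    obtain rfl : l = 0 := by omega
    refine hs ⟨t / M, ?_⟩
    rw [← hMN']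
    rw [hl] at ht
    linear_combination -(N : ℤ) * ht
  · have hd : (numPoints F : ℤ) ∣ N * t - ((N * l : ℕ) : ℤ) := by
      refine ⟨t / M, ?_⟩
      rw [← hMN']
      rw [hl] at ht
      push_cast
      linear_combination -(N : ℤ) * ht
    rw [zpow_eq_zpow_mul_zpow_sub ((N * l : ℕ) : ℤ), mul_pow,
      (zpow_pow_card_sub_one_eq_one_iff hK hω _).2 hd, mul_one]

end Reduction

end ConicReduction

/-! ### The criterion. -/

theorem proposition4p3 {F K : Type*} [Field F] [Fintype F] [Field K] [Fintype K] [DecidableEq K]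
    [Algebra F K] (hodd : Odd (Fintype.card F)) (hK : Module.finrank F K = 3)
    (ω : Kˣ) (hω : ConicReduction.IsPrimitiveElement ω)
    (M N : ℕ) (hMN : M * N = Fintype.card F ^ 2 + Fintype.card F + 1)
    (harc : ConicReduction.IsArc M (ConicReduction.cyclotomicPoints F ω N))
    (r : ZMod (ConicReduction.numPoints F) → ℤ)
    (hr : ∀ i, (r i : ZMod (ConicReduction.numPoints F)) = i)
    (d₀ : ZMod (ConicReduction.numPoints F)) (hd₀ : d₀ ∈ ConicReduction.conicSet F ω) :
    ConicReduction.IsPurelySubset (ConicReduction.X₁ F ω N r d₀) ↔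
      ∀ ℓ : ℕ, 1 ≤ ℓ → ℓ ≤ M - 1 →
        quadraticChar K 2 ≠
          quadraticChar K (1 + (ω : K) ^ (ℓ * (Fintype.card F ^ 3 - 1) / M)) := by
  open ConicReduction in
  have hn := odd_numPoints F
  change M * N = numPoints F at hMN
  have hNn : N ∣ numPoints F := ⟨M, by rw [← hMN, mul_comm]⟩
  have hpos : 0 < numPoints F := hn.pos
  have hM : 0 < M := Nat.pos_of_ne_zero (by rintro rfl; omega)
  have hN : 0 < N := Nat.pos_of_dvd_of_pos hNn hpos
  have h2 : (2 : K) ≠ 0 := two_ne_zero_of_odd_card (F := F) hodd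
  rw [isPurelySubset_X₁_iff hNn]
  simp only [pow_mul_card_cube_sub_one_div hM hMN]
  constructor
  · intro H l hl1 hlM
    have hs : ¬ (numPoints F : ℤ) ∣ ((N * l : ℕ) : ℤ) := by
      rw [Int.natCast_dvd_natCast, ← hMN, mul_comm M, Nat.mul_dvd_mul_iff_left hN]
      exact fun h => by have := Nat.le_of_dvd (by omega) h; omega
    rw [quadraticChar_ne_iff h2 (one_add_zpow_pow_ne_zero hK hω hs)]
    generalize hsl : ((N * l : ℕ) : ℤ) = s at hs ⊢
    have hNs : (N : ℤ) ∣ s := by rw [← hsl]; push_cast; exact dvd_mul_right _ _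
    intro hη
    -- An equality of characters for this $\ell$ is to produce a collision: a conic pair with ratio
    -- $\omega^s$, where $s=N\ell$.
    have hu : ((((ω ^ s : Kˣ) : K)) ^ 2) ^ Fintype.card F ≠ ((ω ^ s : Kˣ) : K) ^ 2 := by
      have e : ((ω ^ s : Kˣ) : K) ^ 2 = ((ω ^ (s * 2) : Kˣ) : K) := by rw [zpow_mul]; norm_cast
      rw [e, Ne, zpow_pow_card_eq_iff hK hω]
      refine fun h => hs (IsCoprime.dvd_of_dvd_mul_right ?_ h)
      rw [Int.isCoprime_iff_gcd_eq_one]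
      exact Nat.coprime_two_right.2 hn
    obtain ⟨i, hi, hi'⟩ := exists_conic_pair hK hω hu
    rw [← Units.val_mul, ← zpow_add] at hi'
    rw [← intCast_mem_conicSet_iff hK hω] at hi hi'
    obtain ⟨k, hk, hki⟩ := exists_zpow_mem_conicElements hodd hK hω hr hd₀ hi
    obtain ⟨k', hk', hki'⟩ := exists_zpow_mem_conicElements hodd hK hω hr hd₀ hi'
    have hd : (numPoints F : ℤ) ∣ (k' - k) - s := by
      rw [← ZMod.intCast_eq_intCast_iff_dvd_sub]
      push_cast
      rw [hki, hki']
      push_cast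
      ring
    have hne : (k : ZMod (numPoints F)) ≠ k' := by
      rw [Ne, ZMod.intCast_eq_intCast_iff_dvd_sub]
      exact fun h => hs ((dvd_sub_right h).1 hd)
    have hmod : (k : ZMod N) = k' := by
      rw [ZMod.intCast_eq_intCast_iff_dvd_sub]
      have := ((Int.natCast_dvd_natCast.2 hNn).trans hd).add hNs
      rwa [sub_add_cancel] at this
    have heven : Even (k + k') := by
      rw [even_add_iff hodd hK hω hr hd₀ hk hk' hne, zpow_eq_zpow_mul_zpow_sub s (k' - k), mul_pow,
        (zpow_pow_card_sub_one_eq_one_iff hK hω _).2 hd, mul_one]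
      exact hη
    have hI := mem_halfI₁_of_pair hK hω hNn harc (hki ▸ hi) (hki' ▸ hi') hne hmod
    exact hne (intCast_eq_of_two_mul (H k k' hk hk' hI (hmod ▸ hI)
      (intCast_two_mul_eq (hn.of_dvd_nat hNn) hmod heven))).1
  · intro H k k' hk hk' _ _ hkk
    obtain ⟨hmod, heven⟩ := intCast_eq_of_two_mul hkk
    by_contra hcon
    -- Equal parity is already known, so logarithms that differ modulo $2n$ must differ modulo $n$.
    have hne : (k : ZMod (numPoints F)) ≠ k' := fun h => hcon (intCast_two_mul_eq hn h heven)
    have hs : ¬ (numPoints F : ℤ) ∣ k' - k := by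
      rwa [← ZMod.intCast_eq_intCast_iff_dvd_sub]
    rw [even_add_iff hodd hK hω hr hd₀ hk hk' hne] at heven
    obtain ⟨l, hl1, hlM, hl⟩ := exists_zpow_pow_card_sub_one_eq hK hω hM hMN
      ((ZMod.intCast_eq_intCast_iff_dvd_sub _ _ _).1 hmod) hs
    refine (quadraticChar_ne_iff h2 (one_add_zpow_pow_ne_zero hK hω hs)).1 ?_ heven
    rw [hl]
    exact H l hl1 hlM
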